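/- Throughout, subgroups of a profinite group are closed, and "generated" means topologically generated. For a profinite group $G$ and a prime $p$, let $O_p(G)$ be the subgroup generated by all normal pro-$p$ subgroups of $G$, and let the Fitting subgroup $F(G)$ be the subgroup generated by all $O_p(G)$, $p$ prime. A profinite group $Q$ is quasisimple if it is perfect (that is, generated by its commutators) and $Q/Z(Q)$ is simple; a component of $G$ is a subnormal quasisimple subgroup of $G$; the layer $E(G)$ is the subgroup generated by all components of $G$; and the generalised Fitting subgroup $F^*(G)$ is the subgroup generated by $F(G)$ and $E(G)$. The group $G$ is Fitting-degenerate if $F^*(G)=1$. A finite group is primitive if it has a maximal subgroup whose core is trivial. Let $G$ be a non-trivial profinite group. Then $G$ is Fitting-degenerate if and only if for every $x \in G \setminus \{1\}$ there is an open normal subgroup $K$ of $G$ (depending on $x$) such that $G/K$ is primitive and $xK \notin F^*(G/K)$. -/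

import Mathlib

namespace ProfiniteFitting

/-- A profinite group `G` is pro-`p` if every quotient by an open normal subgroup
is a `p`-group, i.e. `G` is an inverse limit of finite `p`-groups. -/
def IsProP (p : ℕ) (G : Type*) [Group G] [TopologicalSpace G] : Prop :=
  ∀ N : Subgroup G, ∀ _ : N.Normal, IsOpen (N : Set G) → IsPGroup p (G ⧸ N)

/-- A topological group is perfect if it is topologically generated by its commutators. -/
def IsTopPerfect (G : Type*) [Group G] [TopologicalSpace G] [IsTopologicalGroup G] : Prop :=
  (commutator G).topologicalClosure = ⊤

/-- A topological group is simple if it is non-trivial and its only closed normal subgroups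
are the trivial subgroup and the whole group. -/
def IsTopSimple (G : Type*) [Group G] [TopologicalSpace G] : Prop :=
  Nontrivial G ∧ ∀ N : Subgroup G, N.Normal → IsClosed (N : Set G) → N = ⊥ ∨ N = ⊤

/-- `Q` is quasisimple if it is perfect and `Q / Z(Q)` (with the quotient topology) is simple. -/
def IsQuasisimple (Q : Type*) [Group Q] [TopologicalSpace Q] [IsTopologicalGroup Q] : Prop :=
  IsTopPerfect Q ∧ IsTopSimple (Q ⧸ Subgroup.center Q)

section

variable (G : Type*) [Group G] [TopologicalSpace G] [IsTopologicalGroup G]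

/-- The `p`-core `O_p(G)`: the closed subgroup generated by all closed normal pro-`p`
subgroups of `G`. -/
def pCore (p : ℕ) : Subgroup G :=
  (sSup {N : Subgroup G | IsClosed (N : Set G) ∧ N.Normal ∧ IsProP p N}).topologicalClosure

/-- The Fitting subgroup `F(G)`: the closed subgroup generated by the `O_p(G)`, `p` prime. -/
def fitting : Subgroup G :=
  (sSup {H : Subgroup G | ∃ p : ℕ, p.Prime ∧ H = pCore G p}).topologicalClosure

variable {G} in
/-- A component of `G` is a closed subnormal quasisimple subgroup. (When a closed subgroup is
subnormal, taking closures of the terms of a subnormal chain yields a chain of closed subgroups,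
so abstract subnormality is the same as subnormality through closed subgroups.) -/
def IsComponent (Q : Subgroup G) : Prop :=
  IsClosed (Q : Set G) ∧ Q.IsSubnormal ∧ IsQuasisimple Q

/-- The layer `E(G)`: the closed subgroup generated by the components of `G`. -/
def layer : Subgroup G :=
  (sSup {Q : Subgroup G | IsComponent Q}).topologicalClosure

/-- The generalised Fitting subgroup `F*(G)`: the closed subgroup generated by
`F(G)` and `E(G)`. -/
def generalizedFitting : Subgroup G :=
  (fitting G ⊔ layer G).topologicalClosure

/-- `G` is Fitting-degenerate if `F*(G)` is trivial. -/
def IsFittingDegenerate : Prop :=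
  generalizedFitting G = ⊥

end

/-- A finite group is primitive if it has a maximal subgroup with trivial core. -/
def IsPrimitiveGroup (G : Type*) [Group G] : Prop :=
  Finite G ∧ ∃ H : Subgroup G, IsCoatom H ∧ H.normalCore = ⊥

end ProfiniteFitting

/-! A continuous surjection onto a discrete group carries `F*` into `F*`
(`generalizedFitting_le_comap`), so an element outside `F*(G/K)` lies outside `F*(G)`. This gives
one direction.

Conversely let `F*(G) = 1` and suppose `x ≠ 1` lies in `F*` modulo every primitive quotient. In a
finite group `F*` lies in `M C(M)` for each minimal normal `M`. Let `R` be the intersection of the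
preimages of all these `M C(M)`, over all primitive quotients; it is closed, normal and contains
`x`. In a primitive quotient the image of `R` has trivial intersection of maximal normal subgroups
(`normalRadical_eq_bot_of_isCoatom`). The open maximal subgroups of `G` intersect trivially, since a
nontrivial intersection would be pronilpotent and so contribute to `F(G)`. Hence the open maximal
normal subgroups of `R` intersect trivially too. Then either `R` is abelian, which makes `F(G)`
nontrivial, or `R` has a non-abelian simple normal subgroup, which is a component of `G`. Both
contradict `F*(G) = 1`. -/

namespace ProfiniteFitting

open Subgroup

/-! ### Minimal and maximal normal subgroups, subnormality and commutators -/

section Abstract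

variable {G : Type*} [Group G]

/-- A minimal non-trivial normal subgroup. -/
def IsMinNormal (M : Subgroup G) : Prop :=
  M.Normal ∧ M ≠ ⊥ ∧ ∀ L : Subgroup G, L.Normal → L ≤ M → L = ⊥ ∨ L = M

/-- A maximal proper normal subgroup. -/
def IsMaxNormal (N : Subgroup G) : Prop :=
  N.Normal ∧ N ≠ ⊤ ∧ ∀ L : Subgroup G, L.Normal → N ≤ L → L = N ∨ L = ⊤

theorem exists_isMinNormal_le [Finite G] (N : Subgroup G) (hN : N.Normal) (hb : N ≠ ⊥) :
    ∃ M, IsMinNormal M ∧ M ≤ N := by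
  obtain ⟨M, ⟨h1, h2, h3⟩, hmin⟩ := WellFounded.has_min (wellFounded_lt (α := Subgroup G))
    {M | M.Normal ∧ M ≠ ⊥ ∧ M ≤ N} ⟨N, hN, hb, le_rfl⟩
  refine ⟨M, ⟨h1, h2, fun L hL hLM => ?_⟩, h3⟩
  by_contra! h
  exact hmin L ⟨hL, h.1, hLM.trans h3⟩ (lt_of_le_of_ne hLM h.2)

theorem exists_isMaxNormal_ge [Finite G] (N : Subgroup G) (hN : N.Normal) (hb : N ≠ ⊤) :
    ∃ M, IsMaxNormal M ∧ N ≤ M := by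
  obtain ⟨M, ⟨h1, h2, h3⟩, hmax⟩ := WellFounded.has_min (wellFounded_gt (α := Subgroup G))
    {M | M.Normal ∧ M ≠ ⊤ ∧ N ≤ M} ⟨N, hN, hb, le_rfl⟩
  refine ⟨M, ⟨h1, h2, fun L hL hLM => ?_⟩, h3⟩
  by_contra! h
  exact hmax L ⟨hL, h.2, h3.trans hLM⟩ (lt_of_le_of_ne hLM (Ne.symm h.1))

theorem IsMaxNormal.comap {G' : Type*} [Group G'] {f : G →* G'} (hf : Function.Surjective f)
    {N : Subgroup G'} (hN : IsMaxNormal N) : IsMaxNormal (N.comap f) := by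
  obtain ⟨h1, h2, h3⟩ := hN
  refine ⟨h1.comap f, fun h => h2 ?_, fun L hL hNL => ?_⟩
  · rw [← map_comap_eq_self_of_surjective hf N, h, map_top_of_surjective f hf]
  · have hk : f.ker ≤ L := (ker_le_comap f N).trans hNL
    have hle : N ≤ L.map f := by
      rw [← map_comap_eq_self_of_surjective hf N]
      exact map_mono hNL
    rw [← comap_map_eq_self hk]
    rcases h3 _ (hL.map f hf) hle with h | h
    · exact Or.inl (by rw [h])
    · exact Or.inr (by rw [h, comap_top])

/-- The intersection of all maximal proper normal subgroups. -/
def normalRadical (G : Type*) [Group G] : Subgroup G :=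
  sInf {N | IsMaxNormal N}

instance normalRadical_characteristic : (normalRadical G).Characteristic := by
  rw [characteristic_iff_le_comap]
  intro φ x hx
  simp only [normalRadical, mem_comap, mem_sInf, Set.mem_ofPred_eq] at hx ⊢
  intro N hN
  exact hx _ (hN.comap (f := φ.toMonoidHom) φ.surjective)

/-- In a group with a core-free maximal subgroup, an abelian minimal normal subgroup is
self-centralizing. -/
theorem centralizer_le_of_isCoatom {H : Subgroup G} (hH : IsCoatom H) (hc : H.normalCore = ⊥)
    {M : Subgroup G} (hM : IsMinNormal M) (hab : M ≤ centralizer M) : centralizer M ≤ M := by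
  obtain ⟨hMn, hM1, -⟩ := hM
  have hMH : M ⊔ H = ⊤ := by
    refine hH.2 _ (lt_of_le_of_ne le_sup_right fun h => hM1 ?_)
    rw [eq_bot_iff, ← hc]
    exact normal_le_normalCore.2 (h ▸ le_sup_left)
  -- It is centralized by `M` and normalized by `H`, and `M ⊔ H` is everything.
  have hDn : (centralizer (M : Set G) ⊓ H).Normal := by
    rw [← normalizer_eq_top_iff, eq_top_iff, ← hMH, sup_le_iff]
    constructor
    · intro m hm
      rw [mem_normalizer_iff]
      have key : ∀ y ∈ centralizer (M : Set G), ∀ m ∈ M, m * y * m⁻¹ = y := fun y hy m hm => by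
        rw [mem_centralizer_iff.1 hy m hm, mul_inv_cancel_right]
      intro y
      constructor
      · intro hy
        rwa [key y hy.1 m hm]
      · intro hy
        have := key _ hy.1 _ (M.inv_mem hm)
        have h2 : y = m * y * m⁻¹ := by rw [← this]; group
        rwa [h2]
    · exact (le_inf (le_normalizer_of_normal) le_normalizer).trans
        (by
          intro h hh
          rw [mem_normalizer_iff] at *
          intro y
          exact and_congr (mem_normalizer_iff.1 hh.1 y) (mem_normalizer_iff.1 hh.2 y))
  have hD : centralizer (M : Set G) ⊓ H = ⊥ := by
    rw [eq_bot_iff, ← hc]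
    exact normal_le_normalCore.2 inf_le_right
  intro c hcM
  obtain ⟨m, hm, h, hh, rfl⟩ := mem_sup_of_normal_left.1 (hMH ▸ mem_top c : c ∈ M ⊔ H)
  have : h ∈ centralizer (M : Set G) ⊓ H :=
    ⟨by simpa using mul_mem (inv_mem (hab hm)) hcM, hh⟩
  rw [hD, mem_bot] at this
  simpa [this] using hm

/-- The radical of `V` is characteristic in `V`, so if nontrivial it contains a minimal normal `M`
of `G`. If `M` is abelian, it is self-centralizing, so `V = M` lies in all its own maximal normal
subgroups. Otherwise `C_V(M)` is proper, and a maximal normal subgroup of `V` above it also contains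
`M`, hence all of `V = M C_V(M)`. -/
theorem normalRadical_eq_bot_of_isCoatom [Finite G] {H : Subgroup G} (hH : IsCoatom H)
    (hc : H.normalCore = ⊥) (V : Subgroup G) [V.Normal]
    (hV : ∀ M : Subgroup G, IsMinNormal M → V ≤ M ⊔ centralizer M) :
    normalRadical V = ⊥ := by
  by_contra hJ
  obtain ⟨M, hM, hMJ⟩ := exists_isMinNormal_le ((normalRadical V).map V.subtype) inferInstance
    (by rwa [Ne, map_eq_bot_iff_of_injective _ V.subtype_injective])
  have hMV : M ≤ V := hMJ.trans (map_subtype_le _)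
  have hMn := hM.1
  have hrad : ∀ N : Subgroup V, IsMaxNormal N → M.subgroupOf V ≤ N := by
    intro N hN v hv
    obtain ⟨w, hw, hwv⟩ := hMJ hv
    rw [← Subtype.ext hwv]
    exact mem_sInf.1 hw N hN
  by_cases hab : M ≤ centralizer M
  · have hC := centralizer_le_of_isCoatom hH hc hM hab
    have hVM : V ≤ M := (hV M hM).trans (sup_le le_rfl hC)
    obtain ⟨N, hN, -⟩ := exists_isMaxNormal_ge (⊥ : Subgroup V) inferInstance (by
      intro h
      have : Subsingleton (Subgroup V) := subsingleton_iff_bot_eq_top.1 h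
      exact hJ (Subsingleton.elim _ _))
    exact hN.2.1 (top_le_iff.1 ((subgroupOf_eq_top.2 hVM).ge.trans (hrad N hN)))
  · obtain ⟨N, hN, hCN⟩ := exists_isMaxNormal_ge ((centralizer (M : Set G)).subgroupOf V)
      inferInstance (fun h => hab (hMV.trans (subgroupOf_eq_top.1 h)))
    refine hN.2.1 (top_le_iff.1 ?_)
    rintro ⟨v, hv⟩ -
    obtain ⟨m, hm, c, hcm, rfl⟩ := mem_sup_of_normal_left.1 (hV M hM hv)
    have hcV : c ∈ V := by simpa using mul_mem (inv_mem (hMV hm)) hv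
    exact mul_mem (hrad N hN (x := ⟨m, hMV hm⟩) hm) (hCN (x := ⟨c, hcV⟩) hcm)

/-- Nilpotent normal subgroups centralize minimal normal subgroups. -/
theorem le_centralizer_of_isNilpotent {M O : Subgroup G} (hM : IsMinNormal M) [O.Normal]
    [Group.IsNilpotent O] : O ≤ centralizer M := by
  have := hM.1
  rw [le_centralizer_iff, ← commutator_eq_bot_iff_le_centralizer]
  refine (hM.2.2 _ inferInstance (commutator_le_left M O)).resolve_right fun h => hM.2.1 ?_
  have hMO : M ≤ O := h ▸ commutator_le_right M O
  have key : ∀ n, M ≤ O.lowerCentralSeries n := by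
    intro n
    induction n with
    | zero => exact hMO
    | succ n ih => exact h.symm.le.trans (commutator_mono ih le_rfl)
  obtain ⟨n, hn⟩ := (isNilpotent_iff_lowerCentralSeries O).1 ‹_›
  simpa [hn] using key n

/-- Each step down a subnormal chain costs one more commutator with `Q`. -/
theorem _root_.Subgroup.IsSubnormal.exists_iterate_commutator_le {Q : Subgroup G} (hQ : Q.IsSubnormal)
    (L : Subgroup G) : ∃ k, (fun X => ⁅X, Q⁆)^[k] L ≤ Q := by
  induction hQ with
  | top => exact ⟨0, le_top⟩
  | step Q K hQK _ hn ih =>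
    obtain ⟨k, hk⟩ := ih
    refine ⟨k + 1, ?_⟩
    have hmono : ∀ k, (fun X => ⁅X, Q⁆)^[k] L ≤ (fun X => ⁅X, K⁆)^[k] L := by
      intro k
      induction k with
      | zero => exact le_rfl
      | succ k ih =>
        simp only [Function.iterate_succ_apply']
        exact commutator_mono ih hQK
    rw [Function.iterate_succ_apply']
    refine (commutator_mono ((hmono k).trans hk) le_rfl).trans (commutator_le.2 ?_)
    intro g hg q hq
    rw [commutatorElement_def]
    have := hn.conj_mem ⟨q, hQK hq⟩ hq ⟨g, hg⟩
    exact mul_mem this (inv_mem hq)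

/-- For perfect `Q`, the three subgroups lemma turns `[X, Q, Q] = 1` into `[X, Q] = 1`, so iterates
can be peeled off. -/
theorem commutator_eq_bot_of_iterate {Q : Subgroup G} (hQ : ⁅Q, Q⁆ = Q) (L : Subgroup G) (k : ℕ)
    (h : (fun X => ⁅X, Q⁆)^[k + 1] L = ⊥) : ⁅L, Q⁆ = ⊥ := by
  induction k with
  | zero => exact h
  | succ k ih =>
    apply ih
    simp only [Function.iterate_succ_apply'] at h ⊢
    set X := (fun X => ⁅X, Q⁆)^[k] L
    have := commutator_commutator_eq_bot_of_rotate (H₁ := Q) (H₂ := Q) (H₃ := X)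
      (by rwa [commutator_comm Q X]) h
    rwa [hQ, commutator_comm] at this

/-- A subnormal quasisimple subgroup is contained in, or centralizes, a given normal subgroup. -/
theorem _root_.Subgroup.IsSubnormal.le_or_le_centralizer {Q : Subgroup G} (hQ : Q.IsSubnormal)
    (hperf : commutator Q = ⊤)
    (hsimp : ∀ A : Subgroup Q, A.Normal → A ≤ center Q ∨ A ⊔ center Q = ⊤)
    (M : Subgroup G) [M.Normal] : Q ≤ M ∨ Q ≤ centralizer M := by
  have hQQ : ⁅Q, Q⁆ = Q := by
    have := congrArg (map Q.subtype) hperf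
    rwa [map_subtype_commutator, ← MonoidHom.range_eq_map, range_subtype] at this
  rcases hsimp (M.subgroupOf Q) inferInstance with h | h
  -- Here `M ∩ Q` is central in `Q`. Iterated commutators of `M` with `Q` fall into `M ∩ Q`, so one
  -- more vanishes.
  · right
    obtain ⟨k, hk⟩ := hQ.exists_iterate_commutator_le M
    have hkM : (fun X => ⁅X, Q⁆)^[k] M ≤ M := by
      clear hk
      induction k with
      | zero => exact le_rfl
      | succ k ih =>
        rw [Function.iterate_succ_apply']
        exact (commutator_mono ih le_rfl).trans (commutator_le_left M Q)
    rw [le_centralizer_iff, ← commutator_eq_bot_iff_le_centralizer]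
    apply commutator_eq_bot_of_iterate hQQ M k
    rw [Function.iterate_succ_apply', commutator_eq_bot_iff_le_centralizer]
    intro x hx
    rw [mem_centralizer_iff]
    intro q hq
    have := h (x := ⟨x, hk hx⟩) (hkM hx)
    exact congrArg Subtype.val (mem_center_iff.1 this ⟨q, hq⟩)
  · left
    have := Subgroup.Normal.commutator_le_of_self_sup_commutative_eq_top h inferInstance
    rw [hperf, top_le_iff, subgroupOf_eq_top] at this
    exact this

end Abstract

/-! ### Bounding `F*` above and below by its generators -/

section Generators

variable {G : Type*} [Group G] [TopologicalSpace G] [IsTopologicalGroup G]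

theorem generalizedFitting_le {T : Subgroup G} (hT : IsClosed (T : Set G))
    (hF : ∀ p : ℕ, p.Prime → ∀ N : Subgroup G, IsClosed (N : Set G) → N.Normal → IsProP p N → N ≤ T)
    (hE : ∀ Q : Subgroup G, IsComponent Q → Q ≤ T) : generalizedFitting G ≤ T := by
  refine topologicalClosure_minimal _ (sup_le ?_ ?_) hT
  · refine topologicalClosure_minimal _ (sSup_le ?_) hT
    rintro _ ⟨p, hp, rfl⟩
    refine topologicalClosure_minimal _ (sSup_le ?_) hT
    rintro N ⟨h1, h2, h3⟩
    exact hF p hp N h1 h2 h3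
  · exact topologicalClosure_minimal _ (sSup_le hE) hT

theorem le_generalizedFitting_of_isProP {p : ℕ} (hp : p.Prime) {N : Subgroup G}
    (hc : IsClosed (N : Set G)) (hn : N.Normal) (h : IsProP p N) : N ≤ generalizedFitting G := by
  have h1 : N ≤ pCore G p := by
    refine le_trans (le_sSup ?_) (le_topologicalClosure _)
    exact ⟨hc, hn, h⟩
  have h2 : pCore G p ≤ fitting G := by
    refine le_trans (le_sSup ?_) (le_topologicalClosure _)
    exact ⟨p, hp, rfl⟩
  exact (h1.trans h2).trans (le_sup_left.trans (le_topologicalClosure _))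

theorem IsComponent.le_generalizedFitting {Q : Subgroup G} (hQ : IsComponent Q) :
    Q ≤ generalizedFitting G := by
  have h1 : Q ≤ layer G := by
    refine le_trans (le_sSup ?_) (le_topologicalClosure _)
    exact hQ
  exact h1.trans (le_sup_right.trans (le_topologicalClosure _))

theorem isClosed_generalizedFitting : IsClosed (generalizedFitting G : Set G) :=
  isClosed_topologicalClosure _

end Generators

/-! ### Quasisimple topological groups -/

section Quasisimple

variable {Q : Type*} [Group Q] [TopologicalSpace Q] [IsTopologicalGroup Q]

theorem IsQuasisimple.of_surjective {Q' : Type*} [Group Q'] [TopologicalSpace Q']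
    [IsTopologicalGroup Q'] [T1Space Q'] [Nontrivial Q'] (hQ : IsQuasisimple Q) (f : Q →* Q')
    (hc : Continuous f) (hf : Function.Surjective f) : IsQuasisimple Q' := by
  obtain ⟨hperf, -, hsimp⟩ := hQ
  have hperf' : IsTopPerfect Q' := by
    have := hf.denseRange.topologicalClosure_map_subgroup hc hperf
    rw [_root_.commutator_def, map_commutator, map_top_of_surjective f hf,
      ← _root_.commutator_def] at this
    exact this
  refine ⟨hperf', ?_, fun N hN hNc => ?_⟩
  · refine QuotientGroup.nontrivial_iff.2 fun htop => ?_
    have hcomm : commutator Q' = ⊥ := by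
      rw [_root_.commutator_def, commutator_eq_bot_iff_le_centralizer, coe_top, centralizer_univ, htop]
    have hb : ((⊥ : Subgroup Q').topologicalClosure) = ⊤ := by
      rw [← hcomm]; exact hperf'
    have hb' : ((⊥ : Subgroup Q').topologicalClosure) ≤ ⊥ :=
      topologicalClosure_minimal _ le_rfl (by simp)
    rw [hb, top_le_iff] at hb'
    have : Subsingleton (Subgroup Q') := subsingleton_iff_bot_eq_top.1 hb'
    exact not_subsingleton Q' ((Subgroup.subsingleton_iff).1 this)
  -- Since `f` maps centre into centre, the pullback of `N` to `Q` contains `center Q`, and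
  -- simplicity of `Q ⧸ center Q` applies to its image there.
  · set g : Q →* Q' ⧸ center Q' := (QuotientGroup.mk' (center Q')).comp f with hg
    have hgs : Function.Surjective g := (QuotientGroup.mk'_surjective _).comp hf
    have hZ : center Q ≤ N.comap g := by
      intro z hz
      have : f z ∈ center Q' := by
        rw [mem_center_iff]
        intro y
        obtain ⟨w, rfl⟩ := hf y
        rw [← map_mul, ← map_mul, mem_center_iff.1 hz w]
      have : g z = 1 := (QuotientGroup.eq_one_iff _).2 this
      rw [mem_comap, this]
      exact one_mem N
    have hcm : ((N.comap g).map (QuotientGroup.mk' (center Q))).comap (QuotientGroup.mk' (center Q))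
        = N.comap g := comap_map_eq_self (by rwa [QuotientGroup.ker_mk'])
    have hcl : IsClosed (((N.comap g).map (QuotientGroup.mk' (center Q)) : Subgroup _) :
        Set (Q ⧸ center Q)) := by
      rw [← (QuotientGroup.isQuotientMap_mk (center Q)).isClosed_preimage]
      have : IsClosed (((N.comap g : Subgroup Q)) : Set Q) :=
        hNc.preimage (QuotientGroup.continuous_mk.comp hc)
      rw [← hcm] at this
      exact this
    rw [← map_comap_eq_self_of_surjective hgs N, ← hcm]
    rcases hsimp _ ((hN.comap g).map _ (QuotientGroup.mk'_surjective _)) hcl with h | h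
    · left
      rw [h, MonoidHom.comap_bot, QuotientGroup.ker_mk', Subgroup.map_eq_bot_iff]
      intro z hz
      rw [MonoidHom.mem_ker]
      refine (QuotientGroup.eq_one_iff _).2 ?_
      rw [mem_center_iff]
      intro y
      obtain ⟨w, rfl⟩ := hf y
      rw [← map_mul, ← map_mul, mem_center_iff.1 hz w]
    · right
      rw [h, comap_top, map_top_of_surjective g hgs]

theorem IsQuasisimple.of_isSimpleGroup [IsSimpleGroup Q] (h : commutator Q ≠ ⊥) :
    IsQuasisimple Q := by
  have hc : commutator Q = ⊤ :=
    (IsSimpleGroup.eq_bot_or_eq_top_of_normal _ inferInstance).resolve_left h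
  refine ⟨?_, ?_, fun N hN _ => ?_⟩
  · rw [IsTopPerfect, hc]
    exact top_le_iff.1 (le_topologicalClosure _)
  · refine QuotientGroup.nontrivial_iff.2 fun htop => ?_
    apply h
    rw [_root_.commutator_def, commutator_eq_bot_iff_le_centralizer, coe_top, centralizer_univ, htop]
  · rw [← map_comap_eq_self_of_surjective (QuotientGroup.mk'_surjective _) N]
    rcases IsSimpleGroup.eq_bot_or_eq_top_of_normal _ (hN.comap (QuotientGroup.mk' _)) with h | h
    · exact Or.inl (by rw [h, Subgroup.map_bot])
    · exact Or.inr (by rw [h, map_top_of_surjective _ (QuotientGroup.mk'_surjective _)])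

theorem IsQuasisimple.of_discreteTopology [DiscreteTopology Q] (hQ : IsQuasisimple Q) :
    commutator Q = ⊤ ∧ ∀ A : Subgroup Q, A.Normal → A ≤ center Q ∨ A ⊔ center Q = ⊤ := by
  obtain ⟨hperf, -, hsimp⟩ := hQ
  have hd : DiscreteTopology (Q ⧸ center Q) := QuotientGroup.discreteTopology (isOpen_discrete _)
  refine ⟨top_le_iff.1 (hperf.symm.le.trans
    (topologicalClosure_minimal _ le_rfl (isClosed_discrete _))), fun A hA => ?_⟩
  have hs := QuotientGroup.mk'_surjective (center Q)
  rcases hsimp _ (hA.map _ hs) (isClosed_discrete _) with h | h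
  · left
    rwa [Subgroup.map_eq_bot_iff, QuotientGroup.ker_mk'] at h
  · right
    have := congrArg (comap (QuotientGroup.mk' (center Q))) h
    rwa [comap_map_eq, QuotientGroup.ker_mk', comap_top] at this

end Quasisimple

/-! ### `F*` of finite groups and of discrete quotients -/

section Finite

variable {P : Type*} [Group P] [TopologicalSpace P] [IsTopologicalGroup P] [DiscreteTopology P]

theorem IsProP.isPGroup {p : ℕ} {Q : Type*} [Group Q] [TopologicalSpace Q] [DiscreteTopology Q]
    (h : IsProP p Q) : IsPGroup p Q :=
  (h ⊥ inferInstance (isOpen_discrete _)).of_equiv QuotientGroup.quotientBot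

theorem generalizedFitting_le_sup_centralizer [Finite P] {M : Subgroup P} (hM : IsMinNormal M) :
    generalizedFitting P ≤ M ⊔ centralizer M := by
  have hMn := hM.1
  refine generalizedFitting_le (isClosed_discrete _) (fun p hp N _ hN h => ?_) fun Q hQ => ?_
  · have : Fact p.Prime := ⟨hp⟩
    have := h.isPGroup.isNilpotent
    exact (le_centralizer_of_isNilpotent hM).trans le_sup_right
  · obtain ⟨h1, h2⟩ := hQ.2.2.of_discreteTopology
    rcases hQ.2.1.le_or_le_centralizer h1 h2 M with h | h
    · exact h.trans le_sup_left
    · exact h.trans le_sup_right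

variable {G : Type*} [Group G] [TopologicalSpace G] [IsTopologicalGroup G]

theorem generalizedFitting_le_comap (f : G →* P) (hc : Continuous f) (hf : Function.Surjective f) :
    generalizedFitting G ≤ (generalizedFitting P).comap f := by
  have hgc (N : Subgroup G) : Continuous (f.subgroupMap N) :=
    (hc.comp continuous_subtype_val).subtype_mk _
  refine generalizedFitting_le (isClosed_generalizedFitting.preimage hc)
    (fun p hp N _ hN h => map_le_iff_le_comap.1 ?_) fun Q hQ => map_le_iff_le_comap.1 ?_
  · refine le_generalizedFitting_of_isProP hp (isClosed_discrete _) (hN.map f hf) ?_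
    intro L hL _
    have hLo := h (L.comap (f.subgroupMap N)) inferInstance ((isOpen_discrete _).preimage (hgc N))
    intro y
    obtain ⟨y, rfl⟩ := QuotientGroup.mk_surjective y
    obtain ⟨n, rfl⟩ := f.subgroupMap_surjective N y
    obtain ⟨k, hk⟩ := hLo (QuotientGroup.mk n)
    refine ⟨k, ?_⟩
    rw [← QuotientGroup.mk_pow, QuotientGroup.eq_one_iff] at hk ⊢
    rwa [← map_pow]
  -- A component may die in the quotient; the trivial group is not quasisimple.
  · rcases subsingleton_or_nontrivial (Q.map f) with h | h
    · rw [eq_bot_of_subsingleton (Q.map f)]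
      exact bot_le
    · exact IsComponent.le_generalizedFitting ⟨isClosed_discrete _, hQ.2.1.map hf,
        hQ.2.2.of_surjective _ (hgc Q) (f.subgroupMap_surjective Q)⟩

end Finite

/-- The Sylow `p`-subgroup is unique, so it contains both elements. -/
theorem exists_pow_prime_pow_mul_eq_one {A : Type*} [Group A] [Finite A] [Group.IsNilpotent A]
    {p : ℕ} (hp : p.Prime) {x y : A} (hx : ∃ k, x ^ p ^ k = 1) (hy : ∃ k, y ^ p ^ k = 1) :
    ∃ k, (x * y) ^ p ^ k = 1 := by
  have : Fact p.Prime := ⟨hp⟩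
  have hz : ∀ z : A, (∃ k, z ^ p ^ k = 1) → IsPGroup p (zpowers z) := by
    rintro z ⟨k, hk⟩ ⟨_, n, rfl⟩
    refine ⟨k, Subtype.ext ?_⟩
    change (z ^ n) ^ p ^ k = 1
    rw [← zpow_natCast, ← zpow_mul, mul_comm, zpow_mul, zpow_natCast, hk, one_zpow]
  obtain ⟨S, hS⟩ := (hz x hx).exists_le_sylow
  obtain ⟨T, hT⟩ := (hz y hy).exists_le_sylow
  have hn : (S : Subgroup A).Normal :=
    (Group.isNilpotent_of_finite_tfae.out 0 3 rfl rfl).1 ‹Group.IsNilpotent A› p this S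
  have := (Sylow.unique_of_normal S hn)
  obtain rfl : T = S := Subsingleton.elim _ _
  obtain ⟨k, hk⟩ := T.2 ⟨x * y, mul_mem (hS (mem_zpowers x)) (hT (mem_zpowers y))⟩
  exact ⟨k, congrArg Subtype.val hk⟩

/-! ### Pronilpotent normal subgroups -/

section Profinite

variable {G : Type*} [Group G] [TopologicalSpace G] [IsTopologicalGroup G] [CompactSpace G]
  [TotallyDisconnectedSpace G]

theorem exists_openNormalSubgroup_notMem {x : G} (hx : x ≠ 1) :
    ∃ K : OpenNormalSubgroup G, x ∉ K.toSubgroup := by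
  obtain ⟨K, hK⟩ := ProfiniteGrp.exist_openNormalSubgroup_sub_open_nhds_of_one
    (isOpen_compl_singleton (x := x)) (by simpa using hx.symm)
  exact ⟨K, fun h => hK h rfl⟩

/-- The pro-`p` elements of `N` form a closed normal pro-`p` subgroup `S`; `p` is chosen so that `S`
is nontrivial. -/
theorem generalizedFitting_ne_bot_of_pronilpotent {N : Subgroup G} (hc : IsClosed (N : Set G))
    (hn : N.Normal) (hN : N ≠ ⊥) (hnil : ∀ K : OpenNormalSubgroup G,
      Group.IsNilpotent (N.map (QuotientGroup.mk' K.toSubgroup))) :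
    generalizedFitting G ≠ ⊥ := by
  obtain ⟨x, hxN, hx⟩ := (N.bot_or_exists_ne_one).resolve_left hN
  obtain ⟨K₀, hK₀⟩ := exists_openNormalSubgroup_notMem hx
  have hfin (K : OpenNormalSubgroup G) : Finite (G ⧸ K.toSubgroup) :=
    quotient_finite_of_isOpen _ K.isOpen'
  obtain ⟨p, hp, hpd⟩ := Nat.exists_prime_and_dvd
    (n := orderOf (x : G ⧸ K₀.toSubgroup)) (by
      rwa [Ne, orderOf_eq_one_iff, QuotientGroup.eq_one_iff])
  have hpow : ∀ (K : OpenNormalSubgroup G) (y : G) (n : ℕ),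
      (y : G ⧸ K.toSubgroup) ^ n = 1 ↔ y ^ n ∈ K.toSubgroup := fun K y n => by
    rw [← QuotientGroup.mk_pow, QuotientGroup.eq_one_iff]
  have hcl : ∀ K : OpenNormalSubgroup G, IsClosed {y : G | ∃ k, y ^ p ^ k ∈ K.toSubgroup} := by
    intro K
    have := (isClosed_discrete {q : G ⧸ K.toSubgroup | ∃ k, q ^ p ^ k = 1}).preimage
      QuotientGroup.continuous_mk
    convert this using 1
    ext y
    exact exists_congr fun k => (hpow K y _).symm
  let S : Subgroup G :=
    { carrier := {y | y ∈ N ∧ ∀ K : OpenNormalSubgroup G, ∃ k, y ^ p ^ k ∈ K.toSubgroup}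
      one_mem' := ⟨N.one_mem, fun K => ⟨0, by simp⟩⟩
      inv_mem' := fun {y} hy => ⟨N.inv_mem hy.1, fun K => (hy.2 K).imp fun k hk => by
        rw [inv_pow]; exact inv_mem hk⟩
      mul_mem' := by
        rintro y z ⟨hy, hyK⟩ ⟨hz, hzK⟩
        refine ⟨mul_mem hy hz, fun K => ?_⟩
        have := hnil K
        have key : ∀ w (hw : w ∈ N) (k : ℕ), (⟨(w : G ⧸ K.toSubgroup), mem_map_of_mem _ hw⟩ :
            N.map (QuotientGroup.mk' K.toSubgroup)) ^ p ^ k = 1 ↔ w ^ p ^ k ∈ K.toSubgroup :=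
          fun w hw k => by
            rw [← hpow, Subtype.ext_iff]
            rfl
        obtain ⟨k, hk⟩ := exists_pow_prime_pow_mul_eq_one hp
          ((hyK K).imp fun k => (key y hy k).2) ((hzK K).imp fun k => (key z hz k).2)
        exact ⟨k, (key (y * z) (mul_mem hy hz) k).1 hk⟩ }
  have hSc : IsClosed (S : Set G) := by
    have : (S : Set G) = (N : Set G) ∩
        ⋂ K : OpenNormalSubgroup G, {y : G | ∃ k, y ^ p ^ k ∈ K.toSubgroup} := by
      ext y
      simp only [Set.mem_inter_iff, Set.mem_iInter]
      rfl
    rw [this]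
    exact hc.inter (isClosed_iInter hcl)
  have hSn : S.Normal := ⟨fun y hy g => ⟨hn.conj_mem y hy.1 g, fun K => (hy.2 K).imp fun k hk => by
    rw [conj_pow]
    exact K.isNormal'.conj_mem _ hk g⟩⟩
  have hSp : IsProP p S := by
    intro L hL hLo y
    obtain ⟨y, rfl⟩ := QuotientGroup.mk_surjective y
    obtain ⟨U, hU, hUL⟩ := isOpen_induced_iff.1 hLo
    have h1 : (1 : G) ∈ U := by
      have : (1 : S) ∈ (Subtype.val ⁻¹' U : Set S) := hUL ▸ one_mem L
      exact this
    obtain ⟨K, hK⟩ := ProfiniteGrp.exist_openNormalSubgroup_sub_open_nhds_of_one hU h1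
    obtain ⟨k, hk⟩ := y.2.2 K
    refine ⟨k, ?_⟩
    rw [← QuotientGroup.mk_pow, QuotientGroup.eq_one_iff]
    have : y ^ p ^ k ∈ (Subtype.val ⁻¹' U : Set S) := hK hk
    rwa [hUL] at this
  have hS1 : S ≠ ⊥ := by
    -- Elements of `N` outside `K₀` that are `p`-elements modulo `K`. By compactness it suffices
    -- that each `T K` is nonempty; it contains `x ^ m`, with `m` the `p'`-part of the order of `x`
    -- modulo `K`, since `p` divides the order of `x` modulo `K₀`.
    let T (K : OpenNormalSubgroup G) : Set G :=
      N ∩ (K₀.toSubgroup : Set G)ᶜ ∩ {y : G | ∃ k, y ^ p ^ k ∈ K.toSubgroup}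
    have hne : ((Set.univ : Set G) ∩ ⋂ K, T K).Nonempty := by
      by_contra hcon
      rw [Set.not_nonempty_iff_eq_empty] at hcon
      have : Nonempty (OpenNormalSubgroup G) := ⟨K₀⟩
      obtain ⟨K, hK⟩ := isCompact_univ.elim_directed_family_closed T
        (fun K => (hc.inter K₀.isOpen'.isClosed_compl).inter (hcl K)) hcon (by
          intro K L
          refine ⟨K ⊓ L, ?_, ?_⟩
          · exact fun y hy => ⟨hy.1, hy.2.imp fun k hk => hk.1⟩
          · exact fun y hy => ⟨hy.1, hy.2.imp fun k hk => hk.2⟩)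
      obtain ⟨a, m, hm, ham⟩ := Nat.exists_eq_pow_mul_and_not_dvd
        (orderOf_pos (x : G ⧸ K.toSubgroup)).ne' p hp.ne_one
      refine Set.eq_empty_iff_forall_notMem.1 hK (x ^ m) ⟨trivial, ⟨pow_mem hxN m, ?_⟩, a, ?_⟩
      · intro h
        exact hm (hpd.trans (orderOf_dvd_of_pow_eq_one ((hpow K₀ x m).2 h)))
      · rw [← pow_mul, mul_comm, ← ham, ← hpow]
        exact pow_orderOf_eq_one _
    obtain ⟨y, -, hy⟩ := hne
    rw [Set.mem_iInter] at hy
    intro h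
    have : y ∈ S := ⟨(hy K₀).1.1, fun K => (hy K).2⟩
    rw [h, mem_bot] at this
    exact (hy K₀).1.2 (this ▸ one_mem _)
  intro h
  exact hS1 (eq_bot_iff.2 (h ▸ le_generalizedFitting_of_isProP hp hSc hSn hSp))

end Profinite

/-! ### Existence of components -/

section ComponentExistence

variable {G : Type*} [Group G]

-- Otherwise `A` and `B` both map onto `G ⧸ N`, while `[A, B] ≤ A ⊓ B ≤ N`, making the quotient
-- abelian.
open scoped commutatorElement in
theorem le_of_inf_le_of_isMaxNormal {N A B : Subgroup G} (hN : IsMaxNormal N)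
    (hab : ¬ commutator G ≤ N) [A.Normal] [B.Normal] (h : A ⊓ B ≤ N) : A ≤ N ∨ B ≤ N := by
  have hNn := hN.1
  by_contra! hcon
  have key : ∀ C : Subgroup G, C.Normal → ¬ C ≤ N → N ⊔ C = ⊤ := fun C hC hCN =>
    (hN.2.2 _ inferInstance le_sup_left).resolve_left fun h => hCN (h ▸ le_sup_right)
  apply hab
  rw [← Subgroup.Normal.quotient_commutative_iff_commutator_le]
  refine ⟨⟨fun x y => ?_⟩⟩
  obtain ⟨x, rfl⟩ := QuotientGroup.mk_surjective x
  obtain ⟨y, rfl⟩ := QuotientGroup.mk_surjective y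
  obtain ⟨m, hm, a, ha, rfl⟩ := mem_sup_of_normal_left.1 (key A ‹_› hcon.1 ▸ mem_top x : x ∈ N ⊔ A)
  obtain ⟨n, hn, b, hb, rfl⟩ := mem_sup_of_normal_left.1 (key B ‹_› hcon.2 ▸ mem_top y : y ∈ N ⊔ B)
  have h1 : ⁅a, b⁆ ∈ N := h (commutator_le_inf A B (commutator_mem_commutator ha hb))
  have h2 : (⁅(a : G ⧸ N), (b : G ⧸ N)⁆) = 1 := (QuotientGroup.eq_one_iff _).2 h1
  rw [commutatorElement_eq_one_iff_mul_comm] at h2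
  simp only [QuotientGroup.mk_mul, (QuotientGroup.eq_one_iff _).2 hm,
    (QuotientGroup.eq_one_iff _).2 hn, one_mul, h2]

theorem exists_le_of_biInf_le_of_isMaxNormal {N : Subgroup G} (hN : IsMaxNormal N)
    (hab : ¬ commutator G ≤ N) {ι : Type*} (f : ι → Subgroup G) (hf : ∀ i, (f i).Normal)
    (s : Finset ι) (h : ⨅ i ∈ s, f i ≤ N) : ∃ i ∈ s, f i ≤ N := by
  classical
  induction s using Finset.induction_on with
  | empty => exact absurd (top_le_iff.1 (by simpa using h)) hN.2.1
  | insert a s _ ih =>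
    rw [Finset.iInf_insert] at h
    have hn : (⨅ i ∈ s, f i).Normal := normal_iInf_normal fun i => normal_iInf_normal fun _ => hf i
    have := hf a
    rcases le_of_inf_le_of_isMaxNormal hN hab h with h | h
    · exact ⟨a, by simp, h⟩
    · obtain ⟨i, hi, hiN⟩ := ih h
      exact ⟨i, by simp [hi], hiN⟩

/-- A normal complement of a maximal normal subgroup with non-abelian quotient is simple and
non-abelian. -/
theorem isSimpleGroup_of_isMaxNormal {N C : Subgroup G} (hN : IsMaxNormal N)
    (hab : ¬ commutator G ≤ N) [C.Normal] (hC : ¬ C ≤ N) (hCN : C ⊓ N = ⊥) :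
    IsSimpleGroup C ∧ commutator C ≠ ⊥ := by
  have hNn := hN.1
  have hsup : ∀ D : Subgroup G, D.Normal → ¬ D ≤ N → N ⊔ D = ⊤ := fun D hD hDN =>
    (hN.2.2 _ inferInstance le_sup_left).resolve_left fun h => hDN (h ▸ le_sup_right)
  have hNC : N ⊔ C = ⊤ := hsup C ‹_› hC
  have hcomm : ∀ n ∈ N, ∀ c ∈ C, n * c = c * n := by
    intro n hn c hc
    rw [← commutatorElement_eq_one_iff_mul_comm, ← mem_bot, ← hCN, inf_comm]
    exact commutator_le_inf N C (commutator_mem_commutator hn hc)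
  refine ⟨?_, fun h => ?_⟩
  · have : Nontrivial C := (nontrivial_iff_ne_bot C).2 fun h => hC (h ▸ bot_le)
    refine ⟨fun L hL => ?_⟩
    -- `G = N C` and `N` centralizes `C`, so normality in `C` passes to `G`.
    have hLn : (L.map C.subtype).Normal := by
      refine ⟨?_⟩
      rintro _ ⟨l, hl, rfl⟩ g
      obtain ⟨n, hn, c, hc, rfl⟩ := mem_sup_of_normal_left.1 (hNC ▸ mem_top g : g ∈ N ⊔ C)
      refine ⟨⟨c, hc⟩ * l * ⟨c, hc⟩⁻¹, hL.conj_mem l hl _, ?_⟩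
      have h1 := hcomm n hn (c * l * c⁻¹) (mul_mem (mul_mem hc l.2) (inv_mem hc))
      simp only [coe_subtype, coe_mul, InvMemClass.coe_inv]
      rw [mul_inv_rev, eq_comm]
      calc n * c * (l : G) * (c⁻¹ * n⁻¹) = (n * (c * l * c⁻¹)) * n⁻¹ := by group
        _ = _ := by rw [h1]; group
    by_cases hLN : L.map C.subtype ≤ N
    · left
      rw [← map_eq_bot_iff_of_injective _ C.subtype_injective, eq_bot_iff, ← hCN]
      exact le_inf (map_subtype_le L) hLN
    · right
      have htop := hsup _ hLn hLN
      rw [eq_top_iff]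
      rintro ⟨c, hc⟩ -
      obtain ⟨n, hn, _, ⟨l, hl, rfl⟩, hnl⟩ := mem_sup_of_normal_left.1
        (htop ▸ mem_top c : c ∈ N ⊔ L.map C.subtype)
      have hnC : n ∈ C ⊓ N := by
        refine mem_inf.2 ⟨?_, hn⟩
        rw [eq_mul_inv_of_mul_eq hnl]
        exact mul_mem hc (inv_mem l.2)
      rw [hCN, mem_bot] at hnC
      subst hnC
      rw [one_mul] at hnl
      have : l = ⟨c, hc⟩ := Subtype.ext hnl
      exact this ▸ hl
  · refine hab (Subgroup.Normal.commutator_le_of_self_sup_commutative_eq_top hNC ?_)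
    rw [_root_.commutator_def, commutator_eq_bot_iff_le_centralizer, coe_top, centralizer_univ,
      top_le_iff] at h
    exact ⟨⟨fun a b => (mem_center_iff.1 (h ▸ mem_top b : b ∈ center C) a)⟩⟩

end ComponentExistence

variable {G : Type*} [Group G] [TopologicalSpace G] [IsTopologicalGroup G] [CompactSpace G]

/-- If some open maximal normal `N` has non-abelian quotient, the intersection `C` of all the others
meets `N` trivially. Compactness and the primality of `N` for finite intersections give `¬ C ≤ N`,
so `C` is non-abelian simple. -/
theorem exists_isComponent_or_commutator_eq_bot {R : Subgroup G} (hRc : IsClosed (R : Set G))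
    (hRn : R.Normal)
    (hrad : ∀ r : R, (∀ N : Subgroup R, IsMaxNormal N → IsOpen (N : Set R) → r ∈ N) → r = 1) :
    commutator R = ⊥ ∨ ∃ Q : Subgroup G, IsComponent Q ∧ Q ≠ ⊥ := by
  by_cases hall : ∀ N : Subgroup R, IsMaxNormal N → IsOpen (N : Set R) → commutator R ≤ N
  · exact Or.inl (eq_bot_iff.2 fun r hr => hrad r fun N h1 h2 => hall N h1 h2 hr)
  right
  push Not at hall
  obtain ⟨N, hN, hNo, hab⟩ := hall
  have : CompactSpace R := isCompact_iff_compactSpace.1 hRc.isCompact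
  let ι := {L : Subgroup R // IsMaxNormal L ∧ IsOpen (L : Set R) ∧ L ≠ N}
  have hcl (i : ι) : IsClosed ((i.1 : Subgroup R) : Set R) := isClosed_of_isOpen _ i.2.2.1
  set C : Subgroup R := ⨅ i : ι, i.1 with hCdef
  have hCn : C.Normal := normal_iInf_normal fun i => i.2.1.1
  have hCN : C ⊓ N = ⊥ := by
    rw [eq_bot_iff]
    rintro r ⟨hrC, hrN⟩
    refine hrad r fun L hL hLo => ?_
    by_cases hLN : L = N
    · exact hLN ▸ hrN
    · exact mem_iInf.1 hrC ⟨L, hL, hLo, hLN⟩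
  have hC : ¬ C ≤ N := by
    intro hle
    obtain ⟨s, hs⟩ := (hNo.isClosed_compl.isCompact).elim_finite_subfamily_closed
      (fun i : ι => ((i.1 : Subgroup R) : Set R)) hcl (by
        rw [Set.eq_empty_iff_forall_notMem]
        rintro r ⟨hr, hr2⟩
        exact hr (hle (mem_iInf.2 fun i => Set.mem_iInter.1 hr2 i)))
    obtain ⟨i, -, hi⟩ := exists_le_of_biInf_le_of_isMaxNormal hN hab (fun i : ι => i.1)
      (fun i => i.2.1.1) s (by
        intro r hr
        by_contra hrN
        refine Set.eq_empty_iff_forall_notMem.1 hs r ⟨hrN, ?_⟩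
        simpa [mem_iInf] using hr)
    rcases i.2.1.2.2 N hN.1 hi with h | h
    · exact i.2.2.2 h.symm
    · exact hN.2.1 h
  obtain ⟨hsimp, hna⟩ := isSimpleGroup_of_isMaxNormal hN hab hC hCN
  let e : C ≃* C.map R.subtype := C.equivMapOfInjective R.subtype R.subtype_injective
  have hCc : IsClosed (C : Set R) := by
    rw [hCdef, coe_iInf]
    exact isClosed_iInter hcl
  have : IsSimpleGroup (C.map R.subtype) := e.symm.isSimpleGroup
  refine ⟨C.map R.subtype, ⟨?_, ?_, ?_⟩, ?_⟩
  · rw [coe_map]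
    exact hRc.isClosedEmbedding_subtypeVal.isClosedMap _ hCc
  · exact hCn.isSubnormal.trans' hRn.isSubnormal
  · refine IsQuasisimple.of_isSimpleGroup fun h => hna ?_
    have := congrArg (map e.symm.toMonoidHom) h
    rwa [_root_.commutator_def, map_commutator, map_top_of_surjective _ e.symm.surjective,
      ← _root_.commutator_def, Subgroup.map_bot] at this
  · exact (nontrivial_iff_ne_bot _).1 inferInstance

/-! ### Open maximal subgroups, primitive quotients and the main argument -/

/-- The quotient by the core of an open maximal subgroup. -/
theorem exists_isPrimitiveGroup_quotient {H : Subgroup G} (hH : IsCoatom H)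
    (ho : IsOpen (H : Set G)) :
    ∃ K : OpenNormalSubgroup G, K.toSubgroup ≤ H ∧ IsPrimitiveGroup (G ⧸ K.toSubgroup) := by
  have hfq := quotient_finite_of_isOpen H ho
  have : H.FiniteIndex := finiteIndex_of_finite_quotient
  let K : OpenNormalSubgroup G :=
    ⟨⟨H.normalCore, isOpen_of_isClosed_of_finiteIndex _
      (H.normalCore_isClosed (isClosed_of_isOpen H ho))⟩, inferInstanceAs H.normalCore.Normal⟩
  have hKH : K.toSubgroup ≤ H := normalCore_le H
  have hs := QuotientGroup.mk'_surjective K.toSubgroup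
  have hcm : (H.map (QuotientGroup.mk' K.toSubgroup)).comap (QuotientGroup.mk' K.toSubgroup) = H :=
    comap_map_eq_self (by rwa [QuotientGroup.ker_mk'])
  refine ⟨K, hKH, quotient_finite_of_isOpen _ K.isOpen', H.map (QuotientGroup.mk' K.toSubgroup),
    ⟨fun h => hH.1 ?_, fun B hB => ?_⟩, ?_⟩
  · rw [← hcm, h, comap_top]
  · have hB' : B.comap (QuotientGroup.mk' K.toSubgroup) = ⊤ := by
      apply hH.2
      exact hcm.symm.trans_lt ((comap_lt_comap_of_surjective hs).2 hB)
    rw [← map_comap_eq_self_of_surjective hs B, hB', map_top_of_surjective _ hs]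
  · set D := (H.map (QuotientGroup.mk' K.toSubgroup)).normalCore
    have h1 : D.comap (QuotientGroup.mk' K.toSubgroup) ≤ H.normalCore := by
      refine normal_le_normalCore.2 ?_
      calc _ ≤ _ := comap_mono (normalCore_le _)
        _ = H := hcm
    rw [← map_comap_eq_self_of_surjective hs D, Subgroup.map_eq_bot_iff, QuotientGroup.ker_mk']
    exact h1

variable [TotallyDisconnectedSpace G]

/-- The intersection `Φ` of the open maximal subgroups maps into the Frattini subgroup of each
finite quotient, which is nilpotent, so `Φ` is pronilpotent. -/
theorem generalizedFitting_ne_bot_of_mem_isCoatom {x : G} (hx : x ≠ 1)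
    (h : ∀ H : Subgroup G, IsCoatom H → IsOpen (H : Set G) → x ∈ H) :
    generalizedFitting G ≠ ⊥ := by
  let Φ : Subgroup G := ⨅ H : {H : Subgroup G // IsCoatom H ∧ IsOpen (H : Set G)}, H.1
  have hmem : ∀ y, y ∈ Φ ↔ ∀ H : Subgroup G, IsCoatom H → IsOpen (H : Set G) → y ∈ H := fun y => by
    simp only [Φ, mem_iInf, Subtype.forall, and_imp]
  have hn : Φ.Normal := by
    refine ⟨fun y hy g => (hmem _).2 fun H hH ho => ?_⟩
    have hc : Continuous (MulAut.conj g).toMonoidHom := by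
      change Continuous fun x => g * x * g⁻¹
      fun_prop
    exact (hmem y).1 hy (H.comap (MulAut.conj g).toMonoidHom)
      (isCoatom_comap_of_surjective (MulAut.conj g).surjective hH) (ho.preimage hc)
  refine generalizedFitting_ne_bot_of_pronilpotent (N := Φ) ?_ hn ?_ fun K => ?_
  · simp only [Φ, coe_iInf]
    exact isClosed_iInter fun H => isClosed_of_isOpen _ H.2.2
  · exact fun hb => hx (by rw [← mem_bot, ← hb]; exact (hmem x).2 h)
  · have : Finite (G ⧸ K.toSubgroup) := quotient_finite_of_isOpen _ K.isOpen'
    have hle : Φ.map (QuotientGroup.mk' K.toSubgroup) ≤ frattini (G ⧸ K.toSubgroup) := by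
      rintro _ ⟨y, hy, rfl⟩
      simp only [frattini, Order.radical, mem_iInf]
      intro M hM
      exact (hmem y).1 hy (M.comap (QuotientGroup.mk' K.toSubgroup))
        (isCoatom_comap_of_surjective (QuotientGroup.mk'_surjective _) hM)
        ((isOpen_discrete _).preimage QuotientGroup.continuous_mk)
    have := frattini_nilpotent (G := G ⧸ K.toSubgroup)
    obtain ⟨n, hn⟩ := (isNilpotent_iff_lowerCentralSeries (frattini (G ⧸ K.toSubgroup))).1 this
    refine (isNilpotent_iff_lowerCentralSeries _).2 ⟨n, eq_bot_iff.2 ?_⟩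
    rw [← hn]
    clear hn
    induction n with
    | zero => exact hle
    | succ n ih => exact commutator_mono ih hle

theorem exists_isPrimitiveGroup_notMem (hG : generalizedFitting G = ⊥) {x : G} (hx : x ≠ 1) :
    ∃ K : OpenNormalSubgroup G, IsPrimitiveGroup (G ⧸ K.toSubgroup) ∧
      (QuotientGroup.mk x : G ⧸ K.toSubgroup) ∉ generalizedFitting (G ⧸ K.toSubgroup) := by
  by_contra! hcon
  let S : Set (Subgroup G) := {L | ∃ K : OpenNormalSubgroup G,
    IsPrimitiveGroup (G ⧸ K.toSubgroup) ∧ ∃ M : Subgroup (G ⧸ K.toSubgroup), IsMinNormal M ∧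
      L = (M ⊔ centralizer M).comap (QuotientGroup.mk' K.toSubgroup)}
  have hSn : ∀ L ∈ S, L.Normal := by
    rintro _ ⟨K, -, M, hM, rfl⟩
    have := hM.1
    infer_instance
  have hSc : ∀ L ∈ S, IsClosed (L : Set G) := by
    rintro _ ⟨K, -, M, hM, rfl⟩
    exact (isClosed_discrete ((M ⊔ centralizer M : Subgroup _) : Set (G ⧸ K.toSubgroup))).preimage
      QuotientGroup.continuous_mk
  set R : Subgroup G := sInf S with hR
  have hRn : R.Normal :=
    ⟨fun y hy g => mem_sInf.2 fun L hL => (hSn L hL).conj_mem y (mem_sInf.1 hy L hL) g⟩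
  have hRc : IsClosed (R : Set G) := by
    rw [hR, coe_sInf]
    exact isClosed_biInter hSc
  have hxR : x ∈ R := by
    rw [hR, mem_sInf]
    rintro _ ⟨K, hK, M, hM, rfl⟩
    have := hK.1
    exact generalizedFitting_le_sup_centralizer hM (hcon K hK)
  have hRb : R ≠ ⊥ := fun h => hx (by rwa [h, mem_bot] at hxR)
  have hrad : ∀ r : R, (∀ N : Subgroup R, IsMaxNormal N → IsOpen (N : Set R) → r ∈ N) → r = 1 := by
    intro r hr
    by_contra hr1
    -- It suffices to put `r` in every open maximal `H`; this is checked modulo the core of `H`,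
    -- where the quotient is primitive.
    refine generalizedFitting_ne_bot_of_mem_isCoatom (x := (r : G)) (fun h => hr1 (Subtype.ext h))
      (fun H hH ho => ?_) hG
    obtain ⟨K, hKH, hK⟩ := exists_isPrimitiveGroup_quotient hH ho
    apply hKH
    set f := QuotientGroup.mk' K.toSubgroup
    have hVn : (R.map f).Normal := hRn.map f (QuotientGroup.mk'_surjective _)
    obtain ⟨hfin, H', hH', hc'⟩ := id hK
    have hV := normalRadical_eq_bot_of_isCoatom hH' hc' (R.map f) fun M hM =>
      map_le_iff_le_comap.2 (sInf_le ⟨K, hK, M, hM, rfl⟩)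
    have hcont : Continuous (f.subgroupMap R) :=
      (QuotientGroup.continuous_mk.comp continuous_subtype_val).subtype_mk _
    have hmem : f.subgroupMap R r ∈ normalRadical (R.map f) := by
      refine mem_sInf.2 fun N hN => ?_
      exact hr (N.comap (f.subgroupMap R)) (hN.comap (f.subgroupMap_surjective R))
        ((isOpen_discrete _).preimage hcont)
    rw [hV, mem_bot] at hmem
    exact (QuotientGroup.eq_one_iff _).1 (congrArg Subtype.val hmem)
  rcases exists_isComponent_or_commutator_eq_bot hRc hRn hrad with h | ⟨Q, hQ, hQ1⟩
  · refine generalizedFitting_ne_bot_of_pronilpotent hRc hRn hRb (fun K => ?_) hG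
    rw [isNilpotent_iff_lowerCentralSeries]
    refine ⟨1, ?_⟩
    have h2 := congrArg (map R.subtype) h
    rw [map_subtype_commutator, Subgroup.map_bot] at h2
    rw [Subgroup.lowerCentralSeries_succ, Subgroup.lowerCentralSeries_zero, ← map_commutator, h2, Subgroup.map_bot]
  · exact hQ1 (eq_bot_iff.2 (hG ▸ hQ.le_generalizedFitting))

end ProfiniteFitting

theorem theoremD {G : Type*} [Group G] [TopologicalSpace G] [IsTopologicalGroup G]
    [CompactSpace G] [TotallyDisconnectedSpace G] [Nontrivial G] :
    ProfiniteFitting.IsFittingDegenerate G ↔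
      ∀ x : G, x ≠ 1 → ∃ K : OpenNormalSubgroup G,
        ProfiniteFitting.IsPrimitiveGroup (G ⧸ K.toSubgroup) ∧
        (QuotientGroup.mk x : G ⧸ K.toSubgroup) ∉
          ProfiniteFitting.generalizedFitting (G ⧸ K.toSubgroup) := by
  refine ⟨fun hG x hx => ProfiniteFitting.exists_isPrimitiveGroup_notMem hG hx, fun h => ?_⟩
  refine (Subgroup.eq_bot_iff_forall _).2 fun x hx => ?_
  by_contra hx1
  obtain ⟨K, -, hK⟩ := h x hx1
  exact hK (ProfiniteFitting.generalizedFitting_le_comap (QuotientGroup.mk' K.toSubgroup)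
    QuotientGroup.continuous_mk (QuotientGroup.mk'_surjective _) hx)
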